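/- \textbf{Theorem.} Let $a,m,q,\Lambda\in\mathbb{R}$ and put $$\Delta_\theta=1+\tfrac{a^2\Lambda}{3}\cos^2\theta,\quad \Xi=1+\tfrac{a^2\Lambda}{3},\quad \Delta_r=\left(1-\tfrac{\Lambda}{3}r^2\right)(r^2+a^2)-2mr+q^2,\quad \rho^2=r^2+a^2\cos^2\theta .$$ The Kerr--Newman--(anti-)de Sitter metric with these parameters (Kerr parameter $a$, mass $m$, charge $q$, cosmological constant $\Lambda$) is, in Boyer--Lindquist coordinates $(t,r,\theta,\phi)$, $$ds^2=-\frac{\Delta_r}{\Xi^2\rho^2}\left(dt-a\sin^2\theta\,d\phi\right)^2+\frac{\rho^2}{\Delta_r}dr^2+\frac{\rho^2}{\Delta_\theta}d\theta^2+\frac{\Delta_\theta\sin^2\theta}{\Xi^2\rho^2}\left(a\,dt-(r^2+a^2)\,d\phi\right)^2 .$$ Let $\Gamma^{\lambda}{}_{\mu\nu}=\frac12 g^{\lambda\alpha}(g_{\mu\alpha,\nu}+g_{\nu\alpha,\mu}-g_{\mu\nu,\alpha})$ and $R^{\kappa}{}_{\lambda\mu\nu}=\Gamma^{\kappa}{}_{\lambda\nu,\mu}-\Gamma^{\kappa}{}_{\lambda\mu,\nu}+\Gamma^{\alpha}{}_{\lambda\nu}\Gamma^{\kappa}{}_{\alpha\mu}-\Gamma^{\alpha}{}_{\lambda\mu}\Gamma^{\kappa}{}_{\alpha\nu}$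 be its Christoffel symbols and curvature tensor, with indices lowered and raised by $g_{\mu\nu}$ and its inverse $g^{\mu\nu}$. At every point $(t,r,\theta,\phi)\in\mathbb{R}^4$ where $\Xi$, $\rho^2$, $\Delta_r$, $\Delta_\theta$ and $\sin\theta$ are all nonzero, the Kretschmann scalar $K=R_{\alpha\beta\gamma\delta}R^{\alpha\beta\gamma\delta}$ is $$\begin{aligned}K=\frac{1}{3(r^2+a^2\cos^2\theta)^6}\Big(&8\Lambda^2a^{12}\cos^{12}\theta+48\Lambda^2a^{10}r^2\cos^{10}\theta+120\Lambda^2a^8r^4\cos^8\theta+(160\Lambda^2a^6r^6-144a^6m^2)\cos^6\theta\\&+2160\left(\tfrac1{18}r^8\Lambda^2+m^2r^2-\tfrac23mq^2r+\tfrac7{90}q^4\right)a^4\cos^4\theta\\&-2160\left(-\tfrac1{45}r^8\Lambda^2+m^2r^2-\tfrac43mq^2r+\tfrac{17}{45}q^4\right)a^2r^2\cos^2\theta\\&+8\Lambda^2r^{12}+144m^2r^6-288mq^2r^5+168q^4r^4\Big).\end{aligned}$$ In particular, at such points: \begin{itemize} \item if $a=0$ (Reissner--Nordström--(anti-)de Sitter),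 $\displaystyle K=\frac{8\Lambda^2r^{12}+144m^2r^6-288mq^2r^5+168q^4r^4}{3r^{12}}$; \item if $\Lambda=0$ (Kerr--Newman), $$\begin{aligned}K=\frac{1}{(r^2+a^2\cos^2\theta)^6}\Big(&-48a^6m^2\cos^6\theta+720\left(m^2r^2-\tfrac23mq^2r+\tfrac7{90}q^4\right)a^4\cos^4\theta\\&-720\left(m^2r^2-\tfrac43mq^2r+\tfrac{17}{45}q^4\right)a^2r^2\cos^2\theta+48m^2r^6-96mq^2r^5+56q^4r^4\Big);\end{aligned}$$ \item if $a=0$ and $\Lambda=0$ (Reissner--Nordström), $\displaystyle K=\frac{144m^2r^6-288mq^2r^5+168q^4r^4}{3r^{12}}$. \end{itemize} -/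

import Mathlib

open Real

noncomputable section

namespace CoordGeom

variable {ι : Type*} [Fintype ι] [DecidableEq ι]

/-- The partial derivative `∂f/∂x^μ` at `x` of a function of the coordinates. -/
def pderiv (f : (ι → ℝ) → ℝ) (μ : ι) (x : ι → ℝ) : ℝ :=
  deriv (fun s : ℝ => f (Function.update x μ s)) (x μ)

/-- Christoffel symbols of the second kind `Γ^l_{μν}` of the metric `g` at `x`:
`Γ^l_{μν} = (1/2) g^{lα} (g_{μα,ν} + g_{να,μ} - g_{μν,α})`. -/
def christoffel (g : (ι → ℝ) → Matrix ι ι ℝ) (l μ ν : ι) (x : ι → ℝ) : ℝ :=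
  (1 / 2) * ∑ α, (g x)⁻¹ l α *
    (pderiv (fun y => g y μ α) ν x + pderiv (fun y => g y ν α) μ x
      - pderiv (fun y => g y μ ν) α x)

/-- The curvature tensor with its first index up, `R^κ_{lμν}`:
`R^κ_{lμν} = Γ^κ_{lν,μ} - Γ^κ_{lμ,ν} + Γ^α_{lν} Γ^κ_{αμ} - Γ^α_{lμ} Γ^κ_{αν}`. -/
def riemannUp (g : (ι → ℝ) → Matrix ι ι ℝ) (κ l μ ν : ι) (x : ι → ℝ) : ℝ :=
  pderiv (christoffel g κ l ν) μ x - pderiv (christoffel g κ l μ) ν x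
    + ∑ α, (christoffel g α l ν x * christoffel g κ α μ x
        - christoffel g α l μ x * christoffel g κ α ν x)

/-- The covariant curvature tensor `R_{αβγδ} = g_{ακ} R^κ_{βγδ}`. -/
def riemann (g : (ι → ℝ) → Matrix ι ι ℝ) (α β γ δ : ι) (x : ι → ℝ) : ℝ :=
  ∑ κ, g x α κ * riemannUp g κ β γ δ x

/-- The contravariant curvature tensor
`R^{αβγδ} = g^{αα'} g^{ββ'} g^{γγ'} g^{δδ'} R_{α'β'γ'δ'}`. -/
def riemannContra (g : (ι → ℝ) → Matrix ι ι ℝ) (α β γ δ : ι) (x : ι → ℝ) : ℝ :=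
  ∑ α', ∑ β', ∑ γ', ∑ δ',
    (g x)⁻¹ α α' * (g x)⁻¹ β β' * (g x)⁻¹ γ γ' * (g x)⁻¹ δ δ' * riemann g α' β' γ' δ' x

/-- The Kretschmann scalar `R_{αβγδ} R^{αβγδ}` of the metric `g` at `x`. -/
def kretschmann (g : (ι → ℝ) → Matrix ι ι ℝ) (x : ι → ℝ) : ℝ :=
  ∑ α, ∑ β, ∑ γ, ∑ δ, riemann g α β γ δ x * riemannContra g α β γ δ x

end CoordGeom

namespace KNdS

/-- `Δ_θ = 1 + (a²Λ/3) cos² θ`. -/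
def DeltaTheta (a Λ θ : ℝ) : ℝ := 1 + a ^ 2 * Λ / 3 * cos θ ^ 2

/-- `Ξ = 1 + a²Λ/3`. -/
def Xi (a Λ : ℝ) : ℝ := 1 + a ^ 2 * Λ / 3

/-- `Δ_r = (1 - (Λ/3) r²)(r² + a²) - 2mr + q²`. -/
def DeltaR (a m q Λ r : ℝ) : ℝ :=
  (1 - Λ / 3 * r ^ 2) * (r ^ 2 + a ^ 2) - 2 * m * r + q ^ 2

/-- `ρ² = r² + a² cos² θ`. -/
def rhoSq (a r θ : ℝ) : ℝ := r ^ 2 + a ^ 2 * cos θ ^ 2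

/-- The components of the Kerr-Newman-(anti-)de Sitter metric
`ds² = - Δ_r/(Ξ²ρ²) (dt - a sin²θ dφ)² + (ρ²/Δ_r) dr² + (ρ²/Δ_θ) dθ²
  + Δ_θ sin²θ/(Ξ²ρ²) (a dt - (r² + a²) dφ)²`
in Boyer-Lindquist coordinates `x = (t, r, θ, φ)`; here `x 1 = r` and `x 2 = θ`, and a one-form is
given by its components along `dt, dr, dθ, dφ`. -/
def metric (a m q Λ : ℝ) (x : Fin 4 → ℝ) : Matrix (Fin 4) (Fin 4) ℝ :=
  let r := x 1
  let θ := x 2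
  let τ : Fin 4 → ℝ := ![1, 0, 0, -(a * sin θ ^ 2)]
  let dr : Fin 4 → ℝ := ![0, 1, 0, 0]
  let dθ : Fin 4 → ℝ := ![0, 0, 1, 0]
  let σ : Fin 4 → ℝ := ![a, 0, 0, -(r ^ 2 + a ^ 2)]
  Matrix.of fun μ ν =>
    -(DeltaR a m q Λ r / (Xi a Λ ^ 2 * rhoSq a r θ)) * (τ μ * τ ν)
      + rhoSq a r θ / DeltaR a m q Λ r * (dr μ * dr ν)
      + rhoSq a r θ / DeltaTheta a Λ θ * (dθ μ * dθ ν)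
      + DeltaTheta a Λ θ * sin θ ^ 2 / (Xi a Λ ^ 2 * rhoSq a r θ) * (σ μ * σ ν)

/-- The coordinate points at which the expression for the metric is meaningful and
non-degenerate: no denominator vanishes and the point is off the axis `sin θ = 0`. -/
def Regular (a m q Λ : ℝ) (x : Fin 4 → ℝ) : Prop :=
  Xi a Λ ≠ 0 ∧ rhoSq a (x 1) (x 2) ≠ 0 ∧ DeltaR a m q Λ (x 1) ≠ 0 ∧
    DeltaTheta a Λ (x 2) ≠ 0 ∧ sin (x 2) ≠ 0

end KNdS

end

/-! Cartan's moving-frame calculus replaces a direct computation of Christoffel symbols. The metric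
is diagonal, `g = ∑ h_a e^a ⊗ e^a`, in a frame that is left unnormalised: no square roots occur, all
coefficients stay rational, and the signs of Δ_r and Δ_θ are irrelevant. A connection ω that is
torsion free and satisfies `ωᵀh + hω = dh` must be Levi-Civita (`christoffel_eq`), so ω may be
written down and checked rather than derived. The second structure equation `Ω = dω + ω ∧ ω` then
gives the Riemann tensor (`riemannUp_eq`), and `OrthogonalFrame.kretschmann_eq` reduces the full
contraction to a weighted sum of squares of frame components.

The frame is computed once for Carter's class, with arbitrary functions Q(r) and P(cos θ). Only four
curvature functions survive, and `CarterData.kretschmann_eq` gives K = 4(α² + δ² + 4γ² − 3β²). The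
constant k only rescales t and φ, so Ξ disappears from K. Inserting Q = Δ_r and P = Δ_θ sin²θ leaves
an algebraic identity. -/

namespace CoordGeom

open Matrix Topology Filter
open scoped Kronecker

/-! ### Partial derivatives of scalar and matrix functions -/

section PartialDerivatives

variable {ι : Type*} [DecidableEq ι]

/-- `f` has partial derivative `f'` in the direction of the coordinate `μ` at `x`. -/
def HasPDeriv (f : (ι → ℝ) → ℝ) (f' : ℝ) (μ : ι) (x : ι → ℝ) : Prop :=
  HasDerivAt (fun s : ℝ => f (Function.update x μ s)) f' (x μ)

/-- Entrywise partial derivative of a matrix-valued function. -/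
def HasMatPDeriv {m n : Type*} (M : (ι → ℝ) → Matrix m n ℝ) (M' : Matrix m n ℝ) (μ : ι)
    (x : ι → ℝ) : Prop :=
  ∀ i j, HasPDeriv (fun y => M y i j) (M' i j) μ x

theorem HasPDeriv.pderiv_eq [Fintype ι] {f : (ι → ℝ) → ℝ} {f' : ℝ} {μ : ι} {x : ι → ℝ}
    (hf : HasPDeriv f f' μ x) : pderiv f μ x = f' :=
  HasDerivAt.deriv hf

theorem tendsto_update (x : ι → ℝ) (μ : ι) :
    Tendsto (fun s : ℝ => Function.update x μ s) (𝓝 (x μ)) (𝓝 x) := by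
  have h : Continuous fun s : ℝ => Function.update x μ s :=
    continuous_const.update μ continuous_id
  simpa using h.tendsto (x μ)

/-- The frame identities hold only on an open set. Coordinate lines through `x` stay in it near `x`,
so such identities can still be differentiated. -/
theorem HasPDeriv.congr_of_eventuallyEq {f g : (ι → ℝ) → ℝ} {f' : ℝ} {μ : ι} {x : ι → ℝ}
    (hf : HasPDeriv f f' μ x) (h : g =ᶠ[𝓝 x] f) : HasPDeriv g f' μ x :=
  HasDerivAt.congr_of_eventuallyEq hf ((tendsto_update x μ).eventually h)

theorem HasMatPDeriv.congr_of_eventuallyEq {m n : Type*} {M N : (ι → ℝ) → Matrix m n ℝ}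
    {M' : Matrix m n ℝ} {μ : ι} {x : ι → ℝ} (hM : HasMatPDeriv M M' μ x) (h : N =ᶠ[𝓝 x] M) :
    HasMatPDeriv N M' μ x := fun i j =>
  (hM i j).congr_of_eventuallyEq (h.mono fun y hy => by simp only [hy])

theorem HasMatPDeriv.unique {m n : Type*} {M : (ι → ℝ) → Matrix m n ℝ} {M' M'' : Matrix m n ℝ}
    {μ : ι} {x : ι → ℝ} (h : HasMatPDeriv M M' μ x) (h' : HasMatPDeriv M M'' μ x) : M' = M'' := by
  ext i j
  exact HasDerivAt.unique (h i j) (h' i j)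

theorem HasMatPDeriv.add {m n : Type*} {M N : (ι → ℝ) → Matrix m n ℝ} {M' N' : Matrix m n ℝ}
    {μ : ι} {x : ι → ℝ} (hM : HasMatPDeriv M M' μ x) (hN : HasMatPDeriv N N' μ x) :
    HasMatPDeriv (fun y => M y + N y) (M' + N') μ x := fun i j =>
  HasDerivAt.add (hM i j) (hN i j)

theorem HasMatPDeriv.transpose {m n : Type*} {M : (ι → ℝ) → Matrix m n ℝ} {M' : Matrix m n ℝ}
    {μ : ι} {x : ι → ℝ} (hM : HasMatPDeriv M M' μ x) :
    HasMatPDeriv (fun y => (M y)ᵀ) M'ᵀ μ x := fun i j => hM j i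

theorem HasMatPDeriv.mul {l m n : Type*} [Fintype m] {M : (ι → ℝ) → Matrix l m ℝ}
    {N : (ι → ℝ) → Matrix m n ℝ} {M' : Matrix l m ℝ} {N' : Matrix m n ℝ} {μ : ι} {x : ι → ℝ}
    (hM : HasMatPDeriv M M' μ x) (hN : HasMatPDeriv N N' μ x) :
    HasMatPDeriv (fun y => M y * N y) (M' * N x + M x * N') μ x := by
  intro i j
  have h := HasDerivAt.fun_sum (u := Finset.univ)
    fun k (_ : k ∈ Finset.univ) => HasDerivAt.fun_mul (hM i k) (hN k j)
  simp only [Function.update_eq_self, Finset.sum_add_distrib] at h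
  simp only [HasPDeriv, Matrix.mul_apply, Matrix.add_apply]
  exact h

theorem hasMatPDeriv_diagonal {n : Type*} [DecidableEq n] {h : (ι → ℝ) → n → ℝ} {h' : n → ℝ}
    {μ : ι} {x : ι → ℝ} (hh : ∀ a, HasPDeriv (fun y => h y a) (h' a) μ x) :
    HasMatPDeriv (fun y => diagonal (h y)) (diagonal h') μ x := by
  intro i j
  by_cases hij : i = j
  · subst hij
    simpa using hh i
  · simpa [hij, HasPDeriv] using hasDerivAt_const (x μ) (0 : ℝ)

end PartialDerivatives

/-! ### Levi-Civita connection and curvature in an orthogonal frame -/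

variable {ι : Type*} [Fintype ι] [DecidableEq ι]

/-- The Levi-Civita connection is characterised by being torsion free and metric. Here
`(C ν) l μ` is the connection coefficient `Γ^l_{μν}`. -/
theorem christoffel_eq_of_torsionFree_of_metric {g : (ι → ℝ) → Matrix ι ι ℝ} {x : ι → ℝ}
    (C : ι → Matrix ι ι ℝ) (hg : IsUnit (g x).det) (hsymm : (g x)ᵀ = g x)
    (htor : ∀ l μ ν, C ν l μ = C μ l ν)
    (hmet : ∀ κ, HasMatPDeriv g ((C κ)ᵀ * g x + g x * C κ) κ x) (l μ ν : ι) :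
    christoffel g l μ ν x = C ν l μ := by
  have hd : ∀ μ α ν, pderiv (fun y => g y μ α) ν x = (g x * C ν) α μ + (g x * C ν) μ α := by
    intro μ α ν
    rw [(hmet ν μ α).pderiv_eq, Matrix.add_apply]
    congr 1
    rw [← Matrix.transpose_apply (g x * C ν) μ α, Matrix.transpose_mul, hsymm]
  have hs : ∀ α μ ν, (g x * C ν) α μ = (g x * C μ) α ν := by
    intro α μ ν
    simp only [Matrix.mul_apply, htor _ μ ν]
  -- Koszul's cancellation: metricity produces six lowered coefficients, symmetry in the lower
  -- indices cancels four of them, and the remaining two are equal.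
  have key : ∀ α, pderiv (fun y => g y μ α) ν x + pderiv (fun y => g y ν α) μ x
      - pderiv (fun y => g y μ ν) α x = 2 * (g x * C ν) α μ := by
    intro α
    rw [hd, hd, hd, hs α ν μ, hs μ α ν, hs ν α μ]
    ring
  simp only [christoffel, key]
  have : ∑ α, (g x)⁻¹ l α * (2 * (g x * C ν) α μ) = 2 * ((g x)⁻¹ * (g x * C ν)) l μ := by
    rw [Matrix.mul_apply, Finset.mul_sum]
    exact Finset.sum_congr rfl fun α _ => by ring
  rw [this, ← Matrix.mul_assoc, Matrix.nonsing_inv_mul _ hg, Matrix.one_mul]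
  ring

-- Transforming all four indices is multiplication by one matrix, a fourfold Kronecker product, so
-- changes of frame compose by the mixed-product rule.
omit [DecidableEq ι] in
theorem sum_eq_kronecker_mulVec (M : Matrix ι ι ℝ) (W : ι → ι → ι → ι → ℝ) (α β γ δ : ι) :
    ∑ a, ∑ b, ∑ c, ∑ d, M α a * M β b * M γ c * M δ d * W a b c d
      = (((M ⊗ₖ M) ⊗ₖ (M ⊗ₖ M)) *ᵥ fun p => W p.1.1 p.1.2 p.2.1 p.2.2) ((α, β), (γ, δ)) := by
  simp only [Matrix.mulVec, dotProduct, Fintype.sum_prod_type, Matrix.kroneckerMap_apply,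
    mul_assoc]

/-- A frame of one-forms `e^a` (the rows of `e`) in which `g = ∑ h_a e^a ⊗ e^a` on an open set `U`,
with its dual frame (the columns of `E`), and a torsion-free metric connection
`ω^a_{b μ} = ω μ a b`. The fields `dh`, `de`, `dω` are partial derivatives, the
first index being the direction of differentiation. -/
structure OrthogonalFrame (g : (ι → ℝ) → Matrix ι ι ℝ) (U : Set (ι → ℝ)) where
  e : (ι → ℝ) → Matrix ι ι ℝ
  E : (ι → ℝ) → Matrix ι ι ℝ
  h : (ι → ℝ) → ι → ℝ
  ω : ι → (ι → ℝ) → Matrix ι ι ℝ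
  de : ι → (ι → ℝ) → Matrix ι ι ℝ
  dE : ι → (ι → ℝ) → Matrix ι ι ℝ
  dh : ι → (ι → ℝ) → ι → ℝ
  dω : ι → ι → (ι → ℝ) → Matrix ι ι ℝ
  dde : ι → ι → (ι → ℝ) → Matrix ι ι ℝ
  isOpen : IsOpen U
  metric_eq : ∀ x ∈ U, g x = (e x)ᵀ * diagonal (h x) * e x
  mul_dual : ∀ x ∈ U, e x * E x = 1
  h_ne_zero : ∀ x ∈ U, ∀ a, h x a ≠ 0
  hasPDeriv_e : ∀ x ∈ U, ∀ μ, HasMatPDeriv e (de μ x) μ x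
  hasPDeriv_E : ∀ x ∈ U, ∀ μ, HasMatPDeriv E (dE μ x) μ x
  hasPDeriv_h : ∀ x ∈ U, ∀ μ a, HasPDeriv (fun y => h y a) (dh μ x a) μ x
  hasPDeriv_ω : ∀ x ∈ U, ∀ μ ν, HasMatPDeriv (ω ν) (dω μ ν x) μ x
  hasPDeriv_de : ∀ x ∈ U, ∀ μ ν, HasMatPDeriv (de ν) (dde μ ν x) μ x
  dde_symm : ∀ x ∈ U, ∀ μ ν, dde μ ν x = dde ν μ x
  torsionFree : ∀ x ∈ U, ∀ μ ν a, (de ν x + ω ν x * e x) a μ = (de μ x + ω μ x * e x) a ν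
  isMetric : ∀ x ∈ U, ∀ μ,
    (ω μ x)ᵀ * diagonal (h x) + diagonal (h x) * ω μ x = diagonal (dh μ x)

namespace OrthogonalFrame

variable {g : (ι → ℝ) → Matrix ι ι ℝ} {U : Set (ι → ℝ)} (F : OrthogonalFrame g U)

/-- The curvature two-form `Ω^a_{b μν}` of the connection of the frame. -/
def curvature (μ ν : ι) (x : ι → ℝ) : Matrix ι ι ℝ :=
  F.dω μ ν x - F.dω ν μ x + (F.ω μ x * F.ω ν x - F.ω ν x * F.ω μ x)

/-- The coordinate components `Γ^l_{μν} = connection ν x l μ` of the connection of the frame. -/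
def connection (ν : ι) (x : ι → ℝ) : Matrix ι ι ℝ :=
  F.E x * (F.de ν x + F.ω ν x * F.e x)

variable {x : ι → ℝ} (hx : x ∈ U)

include hx

theorem dual_mul : F.E x * F.e x = 1 := mul_eq_one_comm.mp (F.mul_dual x hx)

theorem e_mul_connection (ν : ι) : F.e x * F.connection ν x = F.de ν x + F.ω ν x * F.e x := by
  rw [connection, ← Matrix.mul_assoc, F.mul_dual x hx, Matrix.one_mul]

theorem mul_inverse :
    g x * (F.E x * diagonal (fun a => (F.h x a)⁻¹) * (F.E x)ᵀ) = 1 := by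
  have h1 : (F.e x)ᵀ * (F.E x)ᵀ = 1 := by
    rw [← Matrix.transpose_mul, F.dual_mul hx, Matrix.transpose_one]
  have h2 : diagonal (F.h x) * diagonal (fun a => (F.h x a)⁻¹) = (1 : Matrix ι ι ℝ) := by
    rw [Matrix.diagonal_mul_diagonal, ← Matrix.diagonal_one]
    congr 1
    funext a
    exact mul_inv_cancel₀ (F.h_ne_zero x hx a)
  calc g x * (F.E x * diagonal (fun a => (F.h x a)⁻¹) * (F.E x)ᵀ)
      = (F.e x)ᵀ * (diagonal (F.h x) * ((F.e x * F.E x) * diagonal (fun a => (F.h x a)⁻¹)))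
          * (F.E x)ᵀ := by
        rw [F.metric_eq x hx]; simp only [Matrix.mul_assoc]
    _ = 1 := by rw [F.mul_dual x hx, Matrix.one_mul, h2, Matrix.mul_one, h1]

theorem inv_metric :
    (g x)⁻¹ = F.E x * diagonal (fun a => (F.h x a)⁻¹) * (F.E x)ᵀ :=
  Matrix.inv_eq_right_inv (F.mul_inverse hx)

theorem christoffel_eq (l μ ν : ι) : christoffel g l μ ν x = F.connection ν x l μ := by
  refine christoffel_eq_of_torsionFree_of_metric (fun ν => F.connection ν x)
    (Matrix.isUnit_det_of_right_inverse (F.mul_inverse hx)) ?_ ?_ ?_ l μ ν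
  · rw [F.metric_eq x hx]
    simp only [Matrix.transpose_mul, Matrix.diagonal_transpose, Matrix.transpose_transpose,
      Matrix.mul_assoc]
  · intro l μ ν
    simp only [connection, Matrix.mul_apply (M := F.E x), F.torsionFree x hx μ ν]
  · intro κ
    have h := (((F.hasPDeriv_e x hx κ).transpose.mul
      (hasMatPDeriv_diagonal (F.hasPDeriv_h x hx κ))).mul
        (F.hasPDeriv_e x hx κ)).congr_of_eventuallyEq
          (Filter.eventuallyEq_of_mem (F.isOpen.mem_nhds hx) F.metric_eq)
    -- With these two forms, `Cᵀg + gC` is the Leibniz expansion of `eᵀ h e` once `ωᵀh + hω` is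
    -- recognised as `dh`.
    have hgC : g x * F.connection κ x
        = (F.e x)ᵀ * diagonal (F.h x) * (F.de κ x + F.ω κ x * F.e x) := by
      rw [F.metric_eq x hx, Matrix.mul_assoc, F.e_mul_connection hx]
    have hCg : (F.connection κ x)ᵀ * g x
        = (F.de κ x + F.ω κ x * F.e x)ᵀ * diagonal (F.h x) * F.e x := by
      rw [F.metric_eq x hx, ← F.e_mul_connection hx, Matrix.transpose_mul]
      simp only [Matrix.mul_assoc]
    rw [hgC, hCg]
    convert h using 1
    rw [← F.isMetric x hx κ]
    simp only [Matrix.transpose_add, Matrix.transpose_mul, Matrix.mul_add, Matrix.add_mul,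
      Matrix.mul_assoc]
    abel

/-- Cartan's second structure equation. -/
theorem riemannUp_eq (κ l μ ν : ι) :
    riemannUp g κ l μ ν x = (F.E x * F.curvature μ ν x * F.e x) κ l := by
  have hev : ∀ κ l ν, (fun y => christoffel g κ l ν y) =ᶠ[𝓝 x] fun y => F.connection ν y κ l :=
    fun κ l ν => Filter.eventuallyEq_of_mem (F.isOpen.mem_nhds hx)
      fun y hy => F.christoffel_eq hy κ l ν
  have hA : ∀ μ ν, HasMatPDeriv (fun y => F.de ν y + F.ω ν y * F.e y)
      (F.dde μ ν x + (F.dω μ ν x * F.e x + F.ω ν x * F.de μ x)) μ x := fun μ ν =>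
    (F.hasPDeriv_de x hx μ ν).add ((F.hasPDeriv_ω x hx μ ν).mul (F.hasPDeriv_e x hx μ))
  -- Only differentiability of Γ is taken from the product `E * A`. Its derivative is found below by
  -- differentiating `e * Γ = de + ω * e`, so the value of `dE` never enters.
  have hex : ∀ μ ν, ∃ D, HasMatPDeriv (F.connection ν) D μ x := fun μ ν =>
    ⟨_, (F.hasPDeriv_E x hx μ).mul (hA μ ν)⟩
  choose D hD using hex
  have heD : ∀ μ ν, F.e x * D μ ν = F.dde μ ν x + F.dω μ ν x * F.e x + F.ω ν x * F.de μ x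
      - F.de μ x * F.connection ν x := by
    intro μ ν
    have h1 := (F.hasPDeriv_e x hx μ).mul (hD μ ν)
    have h2 := (hA μ ν).congr_of_eventuallyEq
      (Filter.eventuallyEq_of_mem (F.isOpen.mem_nhds hx)
        fun y hy => F.e_mul_connection hy ν)
    rw [eq_sub_iff_add_eq', h1.unique h2, add_assoc]
  have hR : riemannUp g κ l μ ν x = (D μ ν - D ν μ + (F.connection μ x * F.connection ν x
      - F.connection ν x * F.connection μ x)) κ l := by
    rw [riemannUp, ((hD μ ν κ l).congr_of_eventuallyEq (hev κ l ν)).pderiv_eq,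
      ((hD ν μ κ l).congr_of_eventuallyEq (hev κ l μ)).pderiv_eq]
    simp only [F.christoffel_eq hx, Matrix.add_apply, Matrix.sub_apply, Matrix.mul_apply,
      Finset.sum_sub_distrib]
    congr 2 <;> exact Finset.sum_congr rfl fun _ _ => mul_comm _ _
  rw [hR]
  -- After multiplication by `e`, the terms `de * Γ` and `ω * de` cancel against those of the
  -- commutator, and the second derivatives of `e` cancel by symmetry.
  have heM : F.e x * (D μ ν - D ν μ + (F.connection μ x * F.connection ν x
      - F.connection ν x * F.connection μ x)) = F.curvature μ ν x * F.e x := by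
    have h1 : ∀ μ ν, F.e x * (F.connection μ x * F.connection ν x)
        = F.de μ x * F.connection ν x + F.ω μ x * F.de ν x + F.ω μ x * F.ω ν x * F.e x := by
      intro μ ν
      rw [← Matrix.mul_assoc, F.e_mul_connection hx, Matrix.add_mul, Matrix.mul_assoc (F.ω μ x),
        F.e_mul_connection hx, Matrix.mul_add, ← Matrix.mul_assoc, add_assoc]
    rw [Matrix.mul_add, Matrix.mul_sub, Matrix.mul_sub, heD, heD, h1, h1, curvature,
      F.dde_symm x hx μ ν]
    simp only [Matrix.add_mul, Matrix.sub_mul]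
    abel
  rw [Matrix.mul_assoc, ← heM, ← Matrix.mul_assoc, F.dual_mul hx, Matrix.one_mul]

theorem riemann_eq (α β γ δ : ι) :
    riemann g α β γ δ x
      = ((F.e x)ᵀ * (diagonal (F.h x) * F.curvature γ δ x) * F.e x) α β := by
  have h : riemann g α β γ δ x = (g x * (F.E x * F.curvature γ δ x * F.e x)) α β := by
    simp only [riemann, F.riemannUp_eq hx, Matrix.mul_apply (M := g x)]
  rw [h, F.metric_eq x hx]
  refine congrFun (congrFun ?_ α) β
  calc (F.e x)ᵀ * diagonal (F.h x) * F.e x * (F.E x * F.curvature γ δ x * F.e x)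
      = (F.e x)ᵀ * diagonal (F.h x) * ((F.e x * F.E x) * F.curvature γ δ x * F.e x) := by
        simp only [Matrix.mul_assoc]
    _ = _ := by rw [F.mul_dual x hx, Matrix.one_mul]; simp only [Matrix.mul_assoc]

omit hx

/-- The Kretschmann scalar in terms of the frame components `W` of the curvature. -/
theorem kretschmann_eq (hx : x ∈ U) (W : ι → ι → ι → ι → ℝ)
    (hW : ∀ μ ν a b, F.h x a * F.curvature μ ν x a b
      = ∑ c, ∑ d, W a b c d * F.e x c μ * F.e x d ν) :
    kretschmann g x = ∑ a, ∑ b, ∑ c, ∑ d,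
      W a b c d ^ 2 * ((F.h x a)⁻¹ * (F.h x b)⁻¹ * ((F.h x c)⁻¹ * (F.h x d)⁻¹)) := by
  -- The Riemann tensor is flattened to a vector `v` with K = v · G4 v. Since `v = e4ᵀ w`, `G4 = E4
  -- · diag · E4ᵀ` and `e4 * E4 = 1`, the frames cancel and a diagonal quadratic form in `w`
  -- remains.
  set e4 := ((F.e x ⊗ₖ F.e x) ⊗ₖ (F.e x ⊗ₖ F.e x)) with he4
  set E4 := ((F.E x ⊗ₖ F.E x) ⊗ₖ (F.E x ⊗ₖ F.E x)) with hE4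
  set G4 := (((g x)⁻¹ ⊗ₖ (g x)⁻¹) ⊗ₖ ((g x)⁻¹ ⊗ₖ (g x)⁻¹)) with hG4
  set w : (ι × ι) × (ι × ι) → ℝ := fun p => W p.1.1 p.1.2 p.2.1 p.2.2 with hw
  set k : ι → ℝ := fun a => (F.h x a)⁻¹ with hk
  set v : (ι × ι) × (ι × ι) → ℝ := fun p => riemann g p.1.1 p.1.2 p.2.1 p.2.2 x with hv
  have hvw : v = e4ᵀ *ᵥ w := by
    funext ⟨⟨α, β⟩, ⟨γ, δ⟩⟩
    have ht : e4ᵀ = (((F.e x)ᵀ ⊗ₖ (F.e x)ᵀ) ⊗ₖ ((F.e x)ᵀ ⊗ₖ (F.e x)ᵀ)) := rfl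
    rw [ht, ← sum_eq_kronecker_mulVec]
    change riemann g α β γ δ x = _
    rw [F.riemann_eq hx]
    simp only [Matrix.mul_apply (N := F.e x), Matrix.mul_apply (M := (F.e x)ᵀ),
      Matrix.diagonal_mul, hW, Matrix.transpose_apply, Finset.sum_mul, Finset.mul_sum]
    rw [Finset.sum_comm]
    exact Finset.sum_congr rfl fun a _ => Finset.sum_congr rfl fun b _ =>
      Finset.sum_congr rfl fun c _ => Finset.sum_congr rfl fun d _ => by ring
  have hK : kretschmann g x = v ⬝ᵥ (G4 *ᵥ v) := by
    simp only [kretschmann, riemannContra, sum_eq_kronecker_mulVec (g x)⁻¹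
      (fun α β γ δ => riemann g α β γ δ x)]
    simp only [dotProduct, Fintype.sum_prod_type]
    rfl
  have hee : e4 * E4 = 1 := by
    simp only [he4, hE4, ← Matrix.mul_kronecker_mul, F.mul_dual x hx, Matrix.one_kronecker_one]
  have hG : G4 = E4 * diagonal (fun p : (ι × ι) × (ι × ι) =>
      k p.1.1 * k p.1.2 * (k p.2.1 * k p.2.2)) * E4ᵀ := by
    have hd : diagonal (fun p : (ι × ι) × (ι × ι) => k p.1.1 * k p.1.2 * (k p.2.1 * k p.2.2))
        = (diagonal k ⊗ₖ diagonal k) ⊗ₖ (diagonal k ⊗ₖ diagonal k) := by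
      simp only [Matrix.diagonal_kronecker_diagonal]
    have ht : E4ᵀ = (((F.E x)ᵀ ⊗ₖ (F.E x)ᵀ) ⊗ₖ ((F.E x)ᵀ ⊗ₖ (F.E x)ᵀ)) := rfl
    rw [hd, ht, hG4, hE4, F.inv_metric hx]
    simp only [Matrix.mul_kronecker_mul]
    rfl
  have hfinal : v ⬝ᵥ (G4 *ᵥ v) = w ⬝ᵥ (diagonal (fun p : (ι × ι) × (ι × ι) =>
      k p.1.1 * k p.1.2 * (k p.2.1 * k p.2.2)) *ᵥ w) := by
    have hEe : E4ᵀ * e4ᵀ = 1 := by rw [← Matrix.transpose_mul, hee, Matrix.transpose_one]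
    rw [hvw, hG, Matrix.mulVec_transpose e4 w, ← Matrix.dotProduct_mulVec,
      ← Matrix.mulVec_transpose e4 w]
    simp only [Matrix.mulVec_mulVec, Matrix.mul_assoc, hEe, Matrix.mul_one]
    rw [← Matrix.mul_assoc, hee, Matrix.one_mul]
  rw [hK, hfinal]
  simp only [dotProduct, Matrix.mulVec_diagonal, Fintype.sum_prod_type, hw, hk]
  exact Finset.sum_congr rfl fun a _ => Finset.sum_congr rfl fun b _ =>
    Finset.sum_congr rfl fun c _ => Finset.sum_congr rfl fun d _ => by ring

end OrthogonalFrame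

noncomputable section

/-! ### Differentiation rules along a coordinate -/

section Calculus

variable {ι : Type*} [DecidableEq ι] {f g : (ι → ℝ) → ℝ} {f' g' : ℝ} {μ : ι} {x : ι → ℝ}

theorem hasPDeriv_const (c : ℝ) : HasPDeriv (fun _ => c) 0 μ x :=
  hasDerivAt_const (x μ) c

theorem HasPDeriv.add (hf : HasPDeriv f f' μ x) (hg : HasPDeriv g g' μ x) :
    HasPDeriv (fun y => f y + g y) (f' + g') μ x :=
  HasDerivAt.add hf hg

theorem HasPDeriv.sub (hf : HasPDeriv f f' μ x) (hg : HasPDeriv g g' μ x) :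
    HasPDeriv (fun y => f y - g y) (f' - g') μ x :=
  HasDerivAt.sub hf hg

theorem HasPDeriv.neg (hf : HasPDeriv f f' μ x) : HasPDeriv (fun y => -f y) (-f') μ x :=
  HasDerivAt.neg hf

theorem HasPDeriv.mul (hf : HasPDeriv f f' μ x) (hg : HasPDeriv g g' μ x) :
    HasPDeriv (fun y => f y * g y) (f' * g x + f x * g') μ x := by
  have h := HasDerivAt.fun_mul hf hg
  simp only [Function.update_eq_self] at h
  exact h

theorem HasPDeriv.const_mul (c : ℝ) (hf : HasPDeriv f f' μ x) :
    HasPDeriv (fun y => c * f y) (c * f') μ x :=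
  HasDerivAt.const_mul c hf

theorem HasPDeriv.sq (hf : HasPDeriv f f' μ x) :
    HasPDeriv (fun y => f y ^ 2) (2 * f x * f') μ x := by
  have h := HasDerivAt.fun_pow hf 2
  simpa [HasPDeriv] using h

theorem HasPDeriv.div (hf : HasPDeriv f f' μ x) (hg : HasPDeriv g g' μ x) (h0 : g x ≠ 0) :
    HasPDeriv (fun y => f y / g y) ((f' * g x - f x * g') / g x ^ 2) μ x := by
  have h := HasDerivAt.fun_div hf hg (by simpa only [Function.update_eq_self] using h0)
  simp only [Function.update_eq_self] at h
  exact h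

theorem HasPDeriv.comp {u : ℝ → ℝ} {u' : ℝ} (hu : HasDerivAt u u' (f x))
    (hf : HasPDeriv f f' μ x) : HasPDeriv (fun y => u (f y)) (u' * f') μ x := by
  have hu' : HasDerivAt u u' (f (Function.update x μ (x μ))) := by
    rwa [Function.update_eq_self]
  exact HasDerivAt.comp (x μ) hu' hf

theorem hasPDeriv_coord (i : ι) :
    HasPDeriv (fun y => y i) (if i = μ then 1 else 0) μ x := by
  by_cases h : i = μ
  · subst h
    simpa [HasPDeriv] using hasDerivAt_id' (x i)
  · simpa [HasPDeriv, h] using hasDerivAt_const (x μ) (x i)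

end Calculus

/-! ### Carter's class of metrics: frame, dual frame and norms -/

/-- Data of a metric of Carter's class
`-Q/ρ² τ² + ρ²/Q dr² + ρ²/P (d cos θ)² + P/ρ² σ²`, with `Q` a function of `r`, `P` a function of
`cos θ`, `ρ² = r² + a² cos² θ`, `τ = k (dt - a sin² θ dφ)` and `σ = k (a dt - (r² + a²) dφ)`. -/
structure CarterData where
  a : ℝ
  k : ℝ
  Q : ℝ → ℝ
  Q' : ℝ → ℝ
  Q'' : ℝ → ℝ
  P : ℝ → ℝ
  P' : ℝ → ℝ
  P'' : ℝ → ℝ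
  k_ne_zero : k ≠ 0
  hasDerivAt_Q : ∀ r, HasDerivAt Q (Q' r) r
  hasDerivAt_Q' : ∀ r, HasDerivAt Q' (Q'' r) r
  hasDerivAt_P : ∀ u, HasDerivAt P (P' u) u
  hasDerivAt_P' : ∀ u, HasDerivAt P' (P'' u) u

namespace CarterData

variable (D : CarterData)

/-- The function `ρ²`. -/
def R (y : Fin 4 → ℝ) : ℝ := y 1 ^ 2 + D.a ^ 2 * cos (y 2) ^ 2

/-- Points at which the metric is meaningful and non-degenerate. -/
def domain : Set (Fin 4 → ℝ) :=
  {y | D.R y ≠ 0 ∧ D.Q (y 1) ≠ 0 ∧ D.P (cos (y 2)) ≠ 0 ∧ sin (y 2) ≠ 0}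

/-- The partial derivatives of `r`. -/
def δr (μ : Fin 4) : ℝ := if 1 = μ then 1 else 0

/-- The partial derivatives of `θ`. -/
def δθ (μ : Fin 4) : ℝ := if 2 = μ then 1 else 0

/-- The partial derivatives of `ρ²`. -/
def dR (μ : Fin 4) (y : Fin 4 → ℝ) : ℝ :=
  2 * y 1 * δr μ + D.a ^ 2 * (2 * cos (y 2) * (-sin (y 2) * δθ μ))

section Atoms

variable (μ : Fin 4) (y : Fin 4 → ℝ)

theorem hasPDeriv_r : HasPDeriv (fun y => y 1) (δr μ) μ y := hasPDeriv_coord 1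

theorem hasPDeriv_cos : HasPDeriv (fun y => cos (y 2)) (-sin (y 2) * δθ μ) μ y :=
  (hasPDeriv_coord 2).comp (f := fun y : Fin 4 → ℝ => y 2) (hasDerivAt_cos (y 2))

theorem hasPDeriv_sin : HasPDeriv (fun y => sin (y 2)) (cos (y 2) * δθ μ) μ y :=
  (hasPDeriv_coord 2).comp (f := fun y : Fin 4 → ℝ => y 2) (hasDerivAt_sin (y 2))

theorem hasPDeriv_Q : HasPDeriv (fun y => D.Q (y 1)) (D.Q' (y 1) * δr μ) μ y :=
  (hasPDeriv_r μ y).comp (f := fun y : Fin 4 → ℝ => y 1) (D.hasDerivAt_Q (y 1))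

theorem hasPDeriv_Q' : HasPDeriv (fun y => D.Q' (y 1)) (D.Q'' (y 1) * δr μ) μ y :=
  (hasPDeriv_r μ y).comp (f := fun y : Fin 4 → ℝ => y 1) (D.hasDerivAt_Q' (y 1))

theorem hasPDeriv_P :
    HasPDeriv (fun y => D.P (cos (y 2))) (D.P' (cos (y 2)) * (-sin (y 2) * δθ μ)) μ y :=
  (hasPDeriv_cos μ y).comp (f := fun y : Fin 4 → ℝ => cos (y 2)) (D.hasDerivAt_P (cos (y 2)))

theorem hasPDeriv_P' :
    HasPDeriv (fun y => D.P' (cos (y 2))) (D.P'' (cos (y 2)) * (-sin (y 2) * δθ μ)) μ y :=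
  (hasPDeriv_cos μ y).comp (f := fun y : Fin 4 → ℝ => cos (y 2)) (D.hasDerivAt_P' (cos (y 2)))

theorem hasPDeriv_R : HasPDeriv D.R (D.dR μ y) μ y :=
  (hasPDeriv_r μ y).sq.add ((hasPDeriv_cos μ y).sq.const_mul (D.a ^ 2))

end Atoms

theorem isOpen_domain : IsOpen D.domain := by
  have hQ : Continuous D.Q := continuous_iff_continuousAt.2 fun r => (D.hasDerivAt_Q r).continuousAt
  have hP : Continuous D.P := continuous_iff_continuousAt.2 fun u => (D.hasDerivAt_P u).continuousAt
  have hR : Continuous D.R := by unfold R; fun_prop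
  exact (isOpen_ne_fun hR continuous_const).inter
    ((isOpen_ne_fun (hQ.comp (continuous_apply 1)) continuous_const).inter
      ((isOpen_ne_fun (hP.comp (continuous_cos.comp (continuous_apply 2))) continuous_const).inter
        (isOpen_ne_fun (continuous_sin.comp (continuous_apply 2)) continuous_const)))

/-- The forms `τ, dr, d cos θ, σ`. -/
def e (y : Fin 4 → ℝ) : Matrix (Fin 4) (Fin 4) ℝ :=
  !![D.k, 0, 0, -(D.k * (D.a * (1 - cos (y 2) ^ 2)));
    0, 1, 0, 0;
    0, 0, -sin (y 2), 0;
    D.k * D.a, 0, 0, -(D.k * (y 1 ^ 2 + D.a ^ 2))]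

/-- The dual frame. -/
def E (y : Fin 4 → ℝ) : Matrix (Fin 4) (Fin 4) ℝ :=
  !![(y 1 ^ 2 + D.a ^ 2) / (D.k * D.R y), 0, 0, -(D.a * (1 - cos (y 2) ^ 2) / (D.k * D.R y));
    0, 1, 0, 0;
    0, 0, -(1 / sin (y 2)), 0;
    D.a / (D.k * D.R y), 0, 0, -(1 / (D.k * D.R y))]

/-- The partial derivatives of `e`. -/
def de (μ : Fin 4) (y : Fin 4 → ℝ) : Matrix (Fin 4) (Fin 4) ℝ :=
  !![0, 0, 0, -(D.k * (D.a * (0 - 2 * cos (y 2) * (-sin (y 2) * δθ μ))));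
    0, 0, 0, 0;
    0, 0, -(cos (y 2) * δθ μ), 0;
    0, 0, 0, -(D.k * (2 * y 1 * δr μ + 0))]

/-- The second partial derivatives of `e`. -/
def dde (μ ν : Fin 4) (y : Fin 4 → ℝ) : Matrix (Fin 4) (Fin 4) ℝ :=
  !![0, 0, 0, D.k * D.a * (2 * (sin (y 2) ^ 2 - cos (y 2) ^ 2)) * δθ μ * δθ ν;
    0, 0, 0, 0;
    0, 0, sin (y 2) * δθ μ * δθ ν, 0;
    0, 0, 0, -(2 * D.k * δr μ * δr ν)]

/-- The partial derivatives of `E`. -/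
def dE (μ : Fin 4) (y : Fin 4 → ℝ) : Matrix (Fin 4) (Fin 4) ℝ :=
  !![((2 * y 1 * δr μ + 0) * (D.k * D.R y) - (y 1 ^ 2 + D.a ^ 2) * (D.k * D.dR μ y))
        / (D.k * D.R y) ^ 2, 0, 0,
      -((D.a * (0 - 2 * cos (y 2) * (-sin (y 2) * δθ μ)) * (D.k * D.R y)
        - D.a * (1 - cos (y 2) ^ 2) * (D.k * D.dR μ y)) / (D.k * D.R y) ^ 2);
    0, 0, 0, 0;
    0, 0, -((0 * sin (y 2) - 1 * (cos (y 2) * δθ μ)) / sin (y 2) ^ 2), 0;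
    (0 * (D.k * D.R y) - D.a * (D.k * D.dR μ y)) / (D.k * D.R y) ^ 2, 0, 0,
      -((0 * (D.k * D.R y) - 1 * (D.k * D.dR μ y)) / (D.k * D.R y) ^ 2)]

/-- The squares of the norms of the frame vectors. -/
def h (y : Fin 4 → ℝ) : Fin 4 → ℝ :=
  ![-(D.Q (y 1) / D.R y), D.R y / D.Q (y 1), D.R y / D.P (cos (y 2)), D.P (cos (y 2)) / D.R y]

/-- The partial derivatives of `h`. -/
def dh (μ : Fin 4) (y : Fin 4 → ℝ) : Fin 4 → ℝ :=
  ![-((D.Q' (y 1) * δr μ * D.R y - D.Q (y 1) * D.dR μ y) / D.R y ^ 2),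
    (D.dR μ y * D.Q (y 1) - D.R y * (D.Q' (y 1) * δr μ)) / D.Q (y 1) ^ 2,
    (D.dR μ y * D.P (cos (y 2)) - D.R y * (D.P' (cos (y 2)) * (-sin (y 2) * δθ μ)))
      / D.P (cos (y 2)) ^ 2,
    (D.P' (cos (y 2)) * (-sin (y 2) * δθ μ) * D.R y - D.P (cos (y 2)) * D.dR μ y) / D.R y ^ 2]

theorem hasMatPDeriv_e (μ : Fin 4) (y : Fin 4 → ℝ) : HasMatPDeriv D.e (D.de μ y) μ y := by
  intro i j
  fin_cases i <;> fin_cases j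
  -- The entries of `de` keep the unsimplified shape (`0 - …`, `… + 0`) produced by the
  -- differentiation rules, so each rule application matches its entry without rewriting.
  all_goals first
    | exact hasPDeriv_const _
    | exact (((hasPDeriv_r μ y).sq.add (hasPDeriv_const _)).const_mul _).neg
    | exact (hasPDeriv_sin μ y).neg
    | exact ((((hasPDeriv_const 1).sub (hasPDeriv_cos μ y).sq).const_mul _).const_mul _).neg

/-! ### Connection coefficients and their derivatives -/

section Coefficients

variable (μ : Fin 4) (y : Fin 4 → ℝ)

/-- `Q/ρ²`. -/
def QdivR : ℝ := D.Q (y 1) / D.R y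

/-- The partial derivatives of `Q/ρ²`. -/
def dQdivR : ℝ :=
  (D.Q' (y 1) * δr μ * D.R y - D.Q (y 1) * (D.dR μ y)) / D.R y ^ 2

variable {y} in
theorem hasPDeriv_QdivR (hy : y ∈ D.domain) : HasPDeriv D.QdivR (D.dQdivR μ y) μ y :=
  (D.hasPDeriv_Q μ y).div (D.hasPDeriv_R μ y) hy.1

/-- `P/ρ²`. -/
def PdivR : ℝ := D.P (cos (y 2)) / D.R y

/-- The partial derivatives of `P/ρ²`. -/
def dPdivR : ℝ :=
  (D.P' (cos (y 2)) * (-sin (y 2) * δθ μ) * D.R y - D.P (cos (y 2)) * (D.dR μ y)) / D.R y ^ 2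

variable {y} in
theorem hasPDeriv_PdivR (hy : y ∈ D.domain) : HasPDeriv D.PdivR (D.dPdivR μ y) μ y :=
  (D.hasPDeriv_P μ y).div (D.hasPDeriv_R μ y) hy.1

/-- `P/Q`. -/
def PdivQ : ℝ := D.P (cos (y 2)) / D.Q (y 1)

/-- The partial derivatives of `P/Q`. -/
def dPdivQ : ℝ :=
  (D.P' (cos (y 2)) * (-sin (y 2) * δθ μ) * D.Q (y 1)
    - D.P (cos (y 2)) * (D.Q' (y 1) * δr μ)) / D.Q (y 1) ^ 2

variable {y} in
theorem hasPDeriv_PdivQ (hy : y ∈ D.domain) : HasPDeriv D.PdivQ (D.dPdivQ μ y) μ y :=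
  (D.hasPDeriv_P μ y).div (D.hasPDeriv_Q μ y) hy.2.1

/-- `Q/P`. -/
def QdivP : ℝ := D.Q (y 1) / D.P (cos (y 2))

/-- The partial derivatives of `Q/P`. -/
def dQdivP : ℝ :=
  (D.Q' (y 1) * δr μ * D.P (cos (y 2))
    - D.Q (y 1) * (D.P' (cos (y 2)) * (-sin (y 2) * δθ μ))) / D.P (cos (y 2)) ^ 2

variable {y} in
theorem hasPDeriv_QdivP (hy : y ∈ D.domain) : HasPDeriv D.QdivP (D.dQdivP μ y) μ y :=
  (D.hasPDeriv_Q μ y).div (D.hasPDeriv_P μ y) hy.2.2.1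

/-- `r/ρ²`. -/
def rdivR : ℝ := y 1 / D.R y

/-- The partial derivatives of `r/ρ²`. -/
def drdivR : ℝ :=
  (δr μ * D.R y - y 1 * (D.dR μ y)) / D.R y ^ 2

variable {y} in
theorem hasPDeriv_rdivR (hy : y ∈ D.domain) : HasPDeriv D.rdivR (D.drdivR μ y) μ y :=
  (hasPDeriv_r μ y).div (D.hasPDeriv_R μ y) hy.1

/-- `cos θ/ρ²`. -/
def cdivR : ℝ := cos (y 2) / D.R y

/-- The partial derivatives of `cos θ/ρ²`. -/
def dcdivR : ℝ :=
  (-sin (y 2) * δθ μ * D.R y - cos (y 2) * (D.dR μ y)) / D.R y ^ 2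

variable {y} in
theorem hasPDeriv_cdivR (hy : y ∈ D.domain) : HasPDeriv D.cdivR (D.dcdivR μ y) μ y :=
  (hasPDeriv_cos μ y).div (D.hasPDeriv_R μ y) hy.1

/-- `Q'/Q`. -/
def logQ : ℝ := D.Q' (y 1) / D.Q (y 1)

/-- The partial derivatives of `Q'/Q`. -/
def dlogQ : ℝ :=
  (D.Q'' (y 1) * δr μ * D.Q (y 1) - D.Q' (y 1) * (D.Q' (y 1) * δr μ)) / D.Q (y 1) ^ 2

variable {y} in
theorem hasPDeriv_logQ (hy : y ∈ D.domain) : HasPDeriv D.logQ (D.dlogQ μ y) μ y :=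
  (D.hasPDeriv_Q' μ y).div (D.hasPDeriv_Q μ y) hy.2.1

/-- `P'/P`. -/
def logP : ℝ := D.P' (cos (y 2)) / D.P (cos (y 2))

/-- The partial derivatives of `P'/P`. -/
def dlogP : ℝ :=
  (D.P'' (cos (y 2)) * (-sin (y 2) * δθ μ) * D.P (cos (y 2))
    - D.P' (cos (y 2)) * (D.P' (cos (y 2)) * (-sin (y 2) * δθ μ))) / D.P (cos (y 2)) ^ 2

variable {y} in
theorem hasPDeriv_logP (hy : y ∈ D.domain) : HasPDeriv D.logP (D.dlogP μ y) μ y :=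
  (D.hasPDeriv_P' μ y).div (D.hasPDeriv_P μ y) hy.2.2.1

/-- The connection coefficient `ω^0_0` along `∂_r`. -/
def cV : ℝ := 1 / 2 * D.logQ y - D.rdivR y

/-- The partial derivatives of `cV`. -/
def dcV : ℝ := 1 / 2 * D.dlogQ μ y - D.drdivR μ y

variable {y} in
theorem hasPDeriv_cV (hy : y ∈ D.domain) : HasPDeriv D.cV (D.dcV μ y) μ y :=
  ((D.hasPDeriv_logQ μ hy).const_mul _).sub (D.hasPDeriv_rdivR μ hy)

/-- The connection coefficient `ω^3_3` along `∂_{cos θ}`. -/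
def cZ : ℝ := 1 / 2 * D.logP y - D.a ^ 2 * D.cdivR y

/-- The partial derivatives of `cZ`. -/
def dcZ : ℝ := 1 / 2 * D.dlogP μ y - D.a ^ 2 * D.dcdivR μ y

variable {y} in
theorem hasPDeriv_cZ (hy : y ∈ D.domain) : HasPDeriv D.cZ (D.dcZ μ y) μ y :=
  ((D.hasPDeriv_logP μ hy).const_mul _).sub ((D.hasPDeriv_cdivR μ hy).const_mul _)

/-- The connection coefficient `ω^0_1 / k` along `∂_t`. -/
def cA : ℝ := D.cV y + D.a ^ 2 * (D.rdivR y * D.PdivQ y)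

/-- The partial derivatives of `cA`. -/
def dcA : ℝ :=
  D.dcV μ y + D.a ^ 2 * (D.drdivR μ y * D.PdivQ y + D.rdivR y * D.dPdivQ μ y)

variable {y} in
theorem hasPDeriv_cA (hy : y ∈ D.domain) : HasPDeriv D.cA (D.dcA μ y) μ y :=
  (D.hasPDeriv_cV μ hy).add
    (((D.hasPDeriv_rdivR μ hy).mul (D.hasPDeriv_PdivQ μ hy)).const_mul _)

/-- The connection coefficient `ω^3_2 / (k a)` along `∂_t`. -/
def cB : ℝ := D.cZ y + D.cdivR y * D.QdivP y

/-- The partial derivatives of `cB`. -/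
def dcB : ℝ := D.dcZ μ y + (D.dcdivR μ y * D.QdivP y + D.cdivR y * D.dQdivP μ y)

variable {y} in
theorem hasPDeriv_cB (hy : y ∈ D.domain) : HasPDeriv D.cB (D.dcB μ y) μ y :=
  (D.hasPDeriv_cZ μ hy).add ((D.hasPDeriv_cdivR μ hy).mul (D.hasPDeriv_QdivP μ hy))

/-- The connection coefficient `ω^0_1 / k` along `∂_φ`. -/
def cC : ℝ := -(D.a * ((1 - cos (y 2) ^ 2) * D.cA y)) - D.a * (y 1 * D.PdivQ y)

/-- The partial derivatives of `cC`. -/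
def dcC : ℝ :=
  -(D.a * ((0 - 2 * cos (y 2) * (-sin (y 2) * δθ μ)) * D.cA y
    + (1 - cos (y 2) ^ 2) * D.dcA μ y)) - D.a * (δr μ * D.PdivQ y + y 1 * D.dPdivQ μ y)

variable {y} in
theorem hasPDeriv_cC (hy : y ∈ D.domain) : HasPDeriv D.cC (D.dcC μ y) μ y :=
  (((((hasPDeriv_const 1).sub (hasPDeriv_cos μ y).sq).mul
    (D.hasPDeriv_cA μ hy)).const_mul _).neg).sub
    (((hasPDeriv_r μ y).mul (D.hasPDeriv_PdivQ μ hy)).const_mul _)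

/-- The connection coefficient `ω^3_2 / k` along `∂_φ`. -/
def cG : ℝ :=
  -(D.a ^ 2 * ((1 - cos (y 2) ^ 2) * D.cB y)) - 1 / 2 * (D.R y * D.logP y) + D.a ^ 2 * cos (y 2)

/-- The partial derivatives of `cG`. -/
def dcG : ℝ :=
  -(D.a ^ 2 * ((0 - 2 * cos (y 2) * (-sin (y 2) * δθ μ)) * D.cB y
    + (1 - cos (y 2) ^ 2) * D.dcB μ y)) - 1 / 2 * (D.dR μ y * D.logP y + D.R y * D.dlogP μ y)
    + D.a ^ 2 * (-sin (y 2) * δθ μ)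

variable {y} in
theorem hasPDeriv_cG (hy : y ∈ D.domain) : HasPDeriv D.cG (D.dcG μ y) μ y :=
  ((((((hasPDeriv_const 1).sub (hasPDeriv_cos μ y).sq).mul
    (D.hasPDeriv_cB μ hy)).const_mul _).neg).sub
    (((D.hasPDeriv_R μ y).mul (D.hasPDeriv_logP μ hy)).const_mul _)).add
    ((hasPDeriv_cos μ y).const_mul _)

end Coefficients

/-! ### Connection matrices and their derivatives -/

/-- The connection forms along `∂_t`. -/
def ωt (y : Fin 4 → ℝ) : Matrix (Fin 4) (Fin 4) ℝ :=
  !![0, D.k * D.cA y, 0, 0;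
    D.k * (D.cA y * D.QdivR y ^ 2), 0, 0, 0;
    0, 0, 0, -(D.k * D.a * (D.cB y * D.PdivR y ^ 2));
    0, 0, D.k * D.a * D.cB y, 0]

/-- The connection forms along `∂_r`. -/
def ωr (y : Fin 4 → ℝ) : Matrix (Fin 4) (Fin 4) ℝ :=
  !![D.cV y, 0, 0, D.a * (D.rdivR y * D.PdivQ y);
    0, -D.cV y, D.a ^ 2 * D.cdivR y, 0;
    0, -(D.a ^ 2 * (D.cdivR y * D.PdivQ y)), D.rdivR y, 0;
    D.a * D.rdivR y, 0, 0, -D.rdivR y]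

/-- The connection forms along `∂_{cos θ}`. -/
def ωc (y : Fin 4 → ℝ) : Matrix (Fin 4) (Fin 4) ℝ :=
  !![-(D.a ^ 2 * D.cdivR y), 0, 0, D.a * D.cdivR y;
    0, D.a ^ 2 * D.cdivR y, -(D.rdivR y * D.QdivP y), 0;
    0, D.rdivR y, -D.cZ y, 0;
    D.a * (D.cdivR y * D.QdivP y), 0, 0, D.cZ y]

/-- The connection forms along `∂_φ`. -/
def ωφ (y : Fin 4 → ℝ) : Matrix (Fin 4) (Fin 4) ℝ :=
  !![0, D.k * D.cC y, D.k * D.a * cos (y 2), 0;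
    D.k * (D.cC y * D.QdivR y ^ 2), 0, 0, D.k * (y 1 * (D.QdivR y * D.PdivR y));
    D.k * D.a * (cos (y 2) * (D.QdivR y * D.PdivR y)), 0, 0, -(D.k * (D.cG y * D.PdivR y ^ 2));
    0, -(D.k * y 1), D.k * D.cG y, 0]

/-- The partial derivatives of `ωt`. -/
def dωt (μ : Fin 4) (y : Fin 4 → ℝ) : Matrix (Fin 4) (Fin 4) ℝ :=
  !![0, D.k * D.dcA μ y, 0, 0;
    D.k * (D.dcA μ y * D.QdivR y ^ 2 + D.cA y * (2 * D.QdivR y * D.dQdivR μ y)), 0, 0, 0;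
    0, 0, 0,
      -(D.k * D.a * (D.dcB μ y * D.PdivR y ^ 2 + D.cB y * (2 * D.PdivR y * D.dPdivR μ y)));
    0, 0, D.k * D.a * D.dcB μ y, 0]

/-- The partial derivatives of `ωr`. -/
def dωr (μ : Fin 4) (y : Fin 4 → ℝ) : Matrix (Fin 4) (Fin 4) ℝ :=
  !![D.dcV μ y, 0, 0, D.a * (D.drdivR μ y * D.PdivQ y + D.rdivR y * D.dPdivQ μ y);
    0, -D.dcV μ y, D.a ^ 2 * D.dcdivR μ y, 0;
    0, -(D.a ^ 2 * (D.dcdivR μ y * D.PdivQ y + D.cdivR y * D.dPdivQ μ y)), D.drdivR μ y, 0;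
    D.a * D.drdivR μ y, 0, 0, -D.drdivR μ y]

/-- The partial derivatives of `ωc`. -/
def dωc (μ : Fin 4) (y : Fin 4 → ℝ) : Matrix (Fin 4) (Fin 4) ℝ :=
  !![-(D.a ^ 2 * D.dcdivR μ y), 0, 0, D.a * D.dcdivR μ y;
    0, D.a ^ 2 * D.dcdivR μ y, -(D.drdivR μ y * D.QdivP y + D.rdivR y * D.dQdivP μ y), 0;
    0, D.drdivR μ y, -D.dcZ μ y, 0;
    D.a * (D.dcdivR μ y * D.QdivP y + D.cdivR y * D.dQdivP μ y), 0, 0, D.dcZ μ y]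

/-- The partial derivatives of `ωφ`. -/
def dωφ (μ : Fin 4) (y : Fin 4 → ℝ) : Matrix (Fin 4) (Fin 4) ℝ :=
  !![0, D.k * D.dcC μ y, D.k * D.a * (-sin (y 2) * δθ μ), 0;
    D.k * (D.dcC μ y * D.QdivR y ^ 2 + D.cC y * (2 * D.QdivR y * D.dQdivR μ y)), 0, 0,
      D.k * (δr μ * (D.QdivR y * D.PdivR y)
        + y 1 * (D.dQdivR μ y * D.PdivR y + D.QdivR y * D.dPdivR μ y));
    D.k * D.a * (-sin (y 2) * δθ μ * (D.QdivR y * D.PdivR y)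
        + cos (y 2) * (D.dQdivR μ y * D.PdivR y + D.QdivR y * D.dPdivR μ y)), 0, 0,
      -(D.k * (D.dcG μ y * D.PdivR y ^ 2 + D.cG y * (2 * D.PdivR y * D.dPdivR μ y)));
    0, -(D.k * δr μ), D.k * D.dcG μ y, 0]

/-- The connection forms. -/
def ω (ν : Fin 4) (y : Fin 4 → ℝ) : Matrix (Fin 4) (Fin 4) ℝ :=
  ![D.ωt y, D.ωr y, -sin (y 2) • D.ωc y, D.ωφ y] ν

/-- The partial derivatives of `ω`. -/
def dω (μ ν : Fin 4) (y : Fin 4 → ℝ) : Matrix (Fin 4) (Fin 4) ℝ :=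
  ![D.dωt μ y, D.dωr μ y,
    -(cos (y 2) * δθ μ) • D.ωc y + -sin (y 2) • D.dωc μ y,
    D.dωφ μ y] ν

section

variable {y : Fin 4 → ℝ} (hy : y ∈ D.domain) (μ : Fin 4)

include hy

theorem hasMatPDeriv_ωt : HasMatPDeriv D.ωt (D.dωt μ y) μ y := by
  intro i j
  fin_cases i <;> fin_cases j
  all_goals first
    | exact hasPDeriv_const _
    | exact (D.hasPDeriv_cA μ hy).const_mul _
    | exact ((D.hasPDeriv_cA μ hy).mul (D.hasPDeriv_QdivR μ hy).sq).const_mul _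
    | exact (((D.hasPDeriv_cB μ hy).mul (D.hasPDeriv_PdivR μ hy).sq).const_mul _).neg
    | exact (D.hasPDeriv_cB μ hy).const_mul _

theorem hasMatPDeriv_ωr : HasMatPDeriv D.ωr (D.dωr μ y) μ y := by
  have hl := D.hasPDeriv_rdivR μ hy
  have hn := D.hasPDeriv_cdivR μ hy
  have hw := D.hasPDeriv_PdivQ μ hy
  intro i j
  fin_cases i <;> fin_cases j
  all_goals first
    | exact hasPDeriv_const _
    | exact D.hasPDeriv_cV μ hy
    | exact (hl.mul hw).const_mul _
    | exact (D.hasPDeriv_cV μ hy).neg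
    | exact hn.const_mul _
    | exact ((hn.mul hw).const_mul _).neg
    | exact hl
    | exact hl.const_mul _
    | exact hl.neg

theorem hasMatPDeriv_ωc : HasMatPDeriv D.ωc (D.dωc μ y) μ y := by
  have hl := D.hasPDeriv_rdivR μ hy
  have hn := D.hasPDeriv_cdivR μ hy
  have hv := D.hasPDeriv_QdivP μ hy
  intro i j
  fin_cases i <;> fin_cases j
  all_goals first
    | exact hasPDeriv_const _
    | exact (hn.const_mul _).neg
    | exact hn.const_mul _
    | exact hn.const_mul _
    | exact (hl.mul hv).neg
    | exact hl
    | exact (D.hasPDeriv_cZ μ hy).neg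
    | exact (hn.mul hv).const_mul _
    | exact D.hasPDeriv_cZ μ hy

theorem hasMatPDeriv_ωφ : HasMatPDeriv D.ωφ (D.dωφ μ y) μ y := by
  have hq := D.hasPDeriv_QdivR μ hy
  have hp := D.hasPDeriv_PdivR μ hy
  intro i j
  fin_cases i <;> fin_cases j
  all_goals first
    | exact hasPDeriv_const _
    | exact (D.hasPDeriv_cC μ hy).const_mul _
    | exact (hasPDeriv_cos μ y).const_mul _
    | exact ((D.hasPDeriv_cC μ hy).mul hq.sq).const_mul _
    | exact ((hasPDeriv_r μ y).mul (hq.mul hp)).const_mul _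
    | exact ((hasPDeriv_cos μ y).mul (hq.mul hp)).const_mul _
    | exact (((D.hasPDeriv_cG μ hy).mul hp.sq).const_mul _).neg
    | exact ((hasPDeriv_r μ y).const_mul _).neg
    | exact (D.hasPDeriv_cG μ hy).const_mul _

theorem hasMatPDeriv_ω (ν : Fin 4) : HasMatPDeriv (D.ω ν) (D.dω μ ν y) μ y := by
  fin_cases ν
  · exact D.hasMatPDeriv_ωt hy μ
  · exact D.hasMatPDeriv_ωr hy μ
  · intro i j
    exact (hasPDeriv_sin μ y).neg.mul (D.hasMatPDeriv_ωc hy μ i j)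
  · exact D.hasMatPDeriv_ωφ hy μ

theorem hasMatPDeriv_E (hk : D.k ≠ 0) : HasMatPDeriv D.E (D.dE μ y) μ y := by
  have hR : D.k * D.R y ≠ 0 := mul_ne_zero hk hy.1
  have hkR := (D.hasPDeriv_R μ y).const_mul D.k
  intro i j
  fin_cases i <;> fin_cases j
  all_goals first
    | exact hasPDeriv_const _
    | exact ((hasPDeriv_r μ y).sq.add (hasPDeriv_const _)).div hkR hR
    | exact ((((hasPDeriv_const 1).sub (hasPDeriv_cos μ y).sq).const_mul _).div hkR hR).neg
    | exact ((hasPDeriv_const 1).div (hasPDeriv_sin μ y) hy.2.2.2).neg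
    | exact (hasPDeriv_const _).div hkR hR
    | exact ((hasPDeriv_const 1).div hkR hR).neg

theorem hasPDeriv_h (i : Fin 4) : HasPDeriv (fun y => D.h y i) (D.dh μ y i) μ y := by
  fin_cases i
  · exact ((D.hasPDeriv_Q μ y).div (D.hasPDeriv_R μ y) hy.1).neg
  · exact (D.hasPDeriv_R μ y).div (D.hasPDeriv_Q μ y) hy.2.1
  · exact (D.hasPDeriv_R μ y).div (D.hasPDeriv_P μ y) hy.2.2.1
  · exact (D.hasPDeriv_P μ y).div (D.hasPDeriv_R μ y) hy.1

omit hy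

theorem hasMatPDeriv_de (ν : Fin 4) : HasMatPDeriv (D.de ν) (D.dde μ ν y) μ y := by
  intro i j
  fin_cases i <;> fin_cases j
  -- Here `dde` is stored in a form visibly symmetric in the two directions, so the raw derivative
  -- has to be simplified to it.
  all_goals first
    | exact hasPDeriv_const _
    | (refine HasDerivAt.congr_deriv ((((((hasPDeriv_r μ y).const_mul 2).mul
        (hasPDeriv_const (δr ν))).add (hasPDeriv_const 0)).const_mul _).neg) ?_
       simp [dde]
       ring)
    | (refine HasDerivAt.congr_deriv ((((hasPDeriv_cos μ y).mul (hasPDeriv_const (δθ ν))).neg)) ?_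
       simp [dde])
    | (refine HasDerivAt.congr_deriv (((((hasPDeriv_const 0).sub
        (((hasPDeriv_cos μ y).const_mul 2).mul
        ((hasPDeriv_sin μ y).neg.mul (hasPDeriv_const (δθ ν))))).const_mul _).const_mul _).neg) ?_
       simp [dde]
       ring)

theorem dde_symm (ν : Fin 4) : D.dde μ ν y = D.dde ν μ y := by
  simp only [dde, mul_right_comm _ (δθ μ) (δθ ν), mul_right_comm _ (δr μ) (δr ν)]

end

/-! ### Duality, first structure equation and metricity -/

theorem δr_apply : δr 0 = 0 ∧ δr 1 = 1 ∧ δr 2 = 0 ∧ δr 3 = 0 := by simp [δr]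

theorem δθ_apply : δθ 0 = 0 ∧ δθ 1 = 0 ∧ δθ 2 = 1 ∧ δθ 3 = 0 := by simp [δθ]

section

variable {y : Fin 4 → ℝ} (hy : y ∈ D.domain)

include hy

/-- The (t, φ) block is inverted using (r² + a²) − a² sin²θ = ρ². -/
theorem e_mul_E (hk : D.k ≠ 0) : D.e y * D.E y = 1 := by
  obtain ⟨hR, -, -, hs⟩ := hy
  have hRdef : D.R y = y 1 ^ 2 + D.a ^ 2 * cos (y 2) ^ 2 := rfl
  ext i j
  fin_cases i <;> fin_cases j
  all_goals
    simp [e, E, Matrix.mul_apply, Fin.sum_univ_four, hs]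
  all_goals
    field_simp
    -- Denominators are cleared while ρ² is an atom known to be nonzero; only afterwards is it
    -- expanded.
    rw [hRdef]
    ring

set_option linter.unusedSimpArgs false in
set_option maxHeartbeats 1600000 in
theorem torsionFree (μ ν i : Fin 4) :
    (D.de ν y + D.ω ν y * D.e y) i μ = (D.de μ y + D.ω μ y * D.e y) i ν := by
  obtain ⟨hR, hQ, hP, hs⟩ := hy
  have hRdef : D.R y = y 1 ^ 2 + D.a ^ 2 * cos (y 2) ^ 2 := rfl
  obtain ⟨r0, r1, r2, r3⟩ := δr_apply
  obtain ⟨t0, t1, t2, t3⟩ := δθ_apply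
  -- The equation is symmetric under exchange of its two sides, so six index pairs suffice.
  wlog hlt : μ < ν generalizing μ ν
  · rcases (not_lt.1 hlt).lt_or_eq with h | h
    · exact (this ν μ h).symm
    · rw [h]
  fin_cases μ <;> fin_cases ν <;> first | exact absurd hlt (by decide) | skip
  all_goals
    fin_cases i <;>
    simp only [e, de, ω, ωt, ωr, ωc, ωφ, Matrix.mul_apply, Matrix.add_apply, Matrix.smul_apply,
      smul_eq_mul, Fin.sum_univ_four, Matrix.of_apply, Matrix.cons_val, Fin.zero_eta, Fin.mk_one,
      Fin.reduceFinMk, r0, r1, r2, r3, t0, t1, t2, t3, cA, cB, cC, cG, cV, cZ, QdivR, PdivR, PdivQ,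
      QdivP, rdivR, cdivR, logQ, logP, mul_zero, zero_mul, mul_one, add_zero, zero_add, sub_zero,
      zero_sub, neg_zero]
  all_goals try field_simp
  all_goals try rw [hRdef]
  all_goals try ring

-- On the diagonal, `ω^a_a` is half the logarithmic derivative of `h_a`. Off the diagonal, `h_a
-- ω^a_b` is antisymmetric; the ratios `h_a / h_b` account for the factors (Q/ρ²)², (P/ρ²)², QP/ρ⁴,
-- Q/P and P/Q in the matrices.
set_option linter.unusedSimpArgs false in
set_option maxHeartbeats 1600000 in
theorem isMetric (μ : Fin 4) :
    (D.ω μ y)ᵀ * diagonal (D.h y) + diagonal (D.h y) * D.ω μ y = diagonal (D.dh μ y) := by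
  obtain ⟨hR, hQ, hP, hs⟩ := hy
  obtain ⟨r0, r1, r2, r3⟩ := δr_apply
  obtain ⟨t0, t1, t2, t3⟩ := δθ_apply
  ext i j
  rw [Matrix.add_apply, Matrix.mul_diagonal, Matrix.diagonal_mul, Matrix.transpose_apply,
    Matrix.diagonal_apply]
  fin_cases μ <;> fin_cases i <;> fin_cases j <;>
    simp only [h, dh, dR, ω, ωt, ωr, ωc, ωφ, Matrix.smul_apply, smul_eq_mul, Matrix.of_apply,
      Matrix.cons_val, Fin.zero_eta, Fin.mk_one, Fin.reduceFinMk, Fin.reduceEq, if_true, if_false,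
      r0, r1, r2, r3, t0, t1,
      t2, t3, cA, cB, cC, cG, cV, cZ, QdivR, PdivR, PdivQ, QdivP, rdivR, cdivR, logQ, logP,
      mul_zero, zero_mul, mul_one, add_zero, zero_add, sub_zero, zero_sub, neg_zero, zero_div]
  all_goals try field_simp
  all_goals try ring

end


/-! ### Curvature and Kretschmann scalar of Carter's class -/

/-- The curvature component `R_{0101}` in the frame. -/
def Wα (y : Fin 4 → ℝ) : ℝ :=
  (1 / 2 * D.R y ^ 2 * D.Q'' (y 1) - 2 * y 1 * D.R y * D.Q' (y 1)
    + (3 * y 1 ^ 2 - D.a ^ 2 * cos (y 2) ^ 2) * (D.Q (y 1) - D.a ^ 2 * D.P (cos (y 2))))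
    / D.R y ^ 3

/-- The curvature component `R_{0123}` in the frame. -/
def Wβ (y : Fin 4 → ℝ) : ℝ :=
  (D.a * D.R y * (cos (y 2) * D.Q' (y 1) - y 1 * D.P' (cos (y 2)))
    - 4 * y 1 * cos (y 2) * D.a * (D.Q (y 1) - D.a ^ 2 * D.P (cos (y 2)))) / D.R y ^ 3

/-- The curvature component `R_{0202}` in the frame, up to the norms of the frame vectors. -/
def Wγ (y : Fin 4 → ℝ) : ℝ :=
  (1 / 2 * D.R y * (y 1 * D.Q' (y 1) + cos (y 2) * D.a ^ 2 * D.P' (cos (y 2)))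
    - (y 1 ^ 2 - D.a ^ 2 * cos (y 2) ^ 2) * (D.Q (y 1) - D.a ^ 2 * D.P (cos (y 2))))
    / D.R y ^ 3

/-- The curvature component `R_{2323}` in the frame. -/
def Wδ (y : Fin 4 → ℝ) : ℝ :=
  (-(1 / 2) * D.R y ^ 2 * D.P'' (cos (y 2)) + 2 * cos (y 2) * D.a ^ 2 * D.R y * D.P' (cos (y 2))
    - (y 1 ^ 2 - 3 * D.a ^ 2 * cos (y 2) ^ 2) * (D.Q (y 1) - D.a ^ 2 * D.P (cos (y 2))))
    / D.R y ^ 3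

/-- The two-form with components `u` along `e⁰ ∧ e¹` and `v` along `e² ∧ e³`. -/
def form01 (u v : ℝ) : Matrix (Fin 4) (Fin 4) ℝ :=
  !![0, u, 0, 0; -u, 0, 0, 0; 0, 0, 0, v; 0, 0, -v, 0]

/-- The two-form with components `u` along `e⁰ ∧ e²` and `v` along `e¹ ∧ e³`. -/
def form02 (u v : ℝ) : Matrix (Fin 4) (Fin 4) ℝ :=
  !![0, 0, u, 0; 0, 0, 0, v; -u, 0, 0, 0; 0, -v, 0, 0]

/-- The two-form with components `u` along `e⁰ ∧ e³` and `v` along `e¹ ∧ e²`. -/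
def form03 (u v : ℝ) : Matrix (Fin 4) (Fin 4) ℝ :=
  !![0, 0, 0, u; 0, 0, v, 0; 0, -v, 0, 0; -u, 0, 0, 0]

/-- The curvature two-forms with both indices down. -/
def W (y : Fin 4 → ℝ) : Fin 4 → Fin 4 → Matrix (Fin 4) (Fin 4) ℝ :=
  let W01 := form01 (D.Wα y) (D.Wβ y)
  let W23 := form01 (D.Wβ y) (D.Wδ y)
  let W02 := form02 (D.Wγ y * D.QdivP y) (D.Wβ y / 2)
  let W13 := form02 (D.Wβ y / 2) (-(D.Wγ y * D.PdivQ y))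
  let W03 := form03 (D.Wγ y * (D.QdivR y * D.PdivR y)) (-(D.Wβ y / 2))
  let W12 := form03 (-(D.Wβ y / 2)) (-(D.Wγ y / (D.QdivR y * D.PdivR y)))
  ![![0, W01, W02, W03], ![-W01, 0, W12, W13], ![-W02, -W12, 0, W23], ![-W03, -W13, -W23, 0]]

/-- The curvature two-form of `ω`. -/
def curv (μ ν : Fin 4) (y : Fin 4 → ℝ) : Matrix (Fin 4) (Fin 4) ℝ :=
  D.dω μ ν y - D.dω ν μ y + (D.ω μ y * D.ω ν y - D.ω ν y * D.ω μ y)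

section

variable {y : Fin 4 → ℝ} (hy : y ∈ D.domain)

include hy

-- The curvature couples only the index pairs (01, 23), (02, 13) and (03, 12); the halves of β agree
-- with the first Bianchi identity. As `e` contains 1 − cos²θ instead of sin²θ, sin θ enters only as
-- a factor from d cos θ, and the identities are rational in r and cos θ, with no trigonometric
-- relation needed.
set_option linter.unusedSimpArgs false in
set_option maxHeartbeats 8000000 in
theorem h_mul_curv_of_lt (μ ν : Fin 4) (hlt : μ < ν) (i j : Fin 4) :
    D.h y i * D.curv μ ν y i j = ((D.e y)ᵀ * D.W y i j * D.e y) μ ν := by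
  obtain ⟨hR, hQ, hP, hs⟩ := hy
  have hRdef : D.R y = y 1 ^ 2 + D.a ^ 2 * cos (y 2) ^ 2 := rfl
  obtain ⟨r0, r1, r2, r3⟩ := δr_apply
  obtain ⟨t0, t1, t2, t3⟩ := δθ_apply
  fin_cases μ <;> fin_cases ν <;> first | exact absurd hlt (by decide) | skip
  all_goals
    fin_cases i <;> fin_cases j <;>
    simp only [h, e, W, form01, form02, form03, curv, dω, dωt, dωr, dωc, dωφ, ω, ωt, ωr, ωc, ωφ,
      Matrix.mul_apply, Matrix.add_apply, Matrix.sub_apply, Matrix.smul_apply, Matrix.neg_apply,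
      Matrix.zero_apply, Matrix.transpose_apply, smul_eq_mul, Fin.sum_univ_four, Matrix.of_apply,
      Matrix.cons_val, Fin.zero_eta, Fin.mk_one, Fin.reduceFinMk, r0, r1, r2, r3, t0, t1, t2, t3,
      mul_zero, zero_mul, mul_one, add_zero, zero_add, sub_zero, zero_sub, neg_zero, sub_self]
  all_goals
    simp only [dcA, dcB, dcC, dcG, dcV, dcZ, dQdivR, dPdivR, dPdivQ, dQdivP, drdivR, dcdivR, dlogQ,
      dlogP, cA, cB, cC, cG, cV, cZ, QdivR, PdivR, PdivQ, QdivP, rdivR, cdivR, logQ, logP, dR,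
      Wα, Wβ, Wγ, Wδ, r0, r1, r2, r3, t0, t1, t2, t3, mul_zero, zero_mul, mul_one, add_zero,
      zero_add, sub_zero, zero_sub, neg_zero]
  all_goals try field_simp
  all_goals try rw [hRdef]
  all_goals try ring

end

variable {y : Fin 4 → ℝ}

theorem W_swap (i j c d : Fin 4) : D.W y i j d c = -D.W y i j c d := by
  fin_cases i <;> fin_cases j <;> fin_cases c <;> fin_cases d <;>
    simp only [W, form01, form02, form03, Matrix.neg_apply, Matrix.zero_apply, Matrix.of_apply,
      Matrix.cons_val, Fin.zero_eta, Fin.mk_one, Fin.reduceFinMk, neg_zero, neg_neg]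

theorem curv_swap (μ ν : Fin 4) : D.curv ν μ y = -D.curv μ ν y := by
  simp only [curv]
  abel

/-- Both sides are antisymmetric in μ and ν, so the case μ < ν decides all others. -/
theorem h_mul_curv (hy : y ∈ D.domain) (μ ν i j : Fin 4) :
    D.h y i * D.curv μ ν y i j = ((D.e y)ᵀ * D.W y i j * D.e y) μ ν := by
  have hW : (D.W y i j)ᵀ = -D.W y i j := by
    ext c d
    exact D.W_swap i j c d
  have hswap : ∀ μ ν, ((D.e y)ᵀ * D.W y i j * D.e y) ν μ
      = -((D.e y)ᵀ * D.W y i j * D.e y) μ ν := by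
    intro μ ν
    rw [← Matrix.transpose_apply ((D.e y)ᵀ * D.W y i j * D.e y) μ ν, Matrix.transpose_mul,
      Matrix.transpose_mul, hW, Matrix.transpose_transpose, Matrix.neg_mul, Matrix.mul_neg,
      Matrix.neg_apply, Matrix.mul_assoc]
  rcases lt_trichotomy μ ν with h | h | h
  · exact D.h_mul_curv_of_lt hy μ ν h i j
  · subst h
    have h1 : D.curv μ μ y = 0 := by simp [curv]
    have h2 := hswap μ μ
    rw [h1, Matrix.zero_apply, mul_zero]
    linarith
  · rw [D.curv_swap ν μ, hswap ν μ, Matrix.neg_apply, mul_neg, D.h_mul_curv_of_lt hy ν μ h i j]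

/-- The orthogonal frame of a metric of Carter's class. -/
def frame {g : (Fin 4 → ℝ) → Matrix (Fin 4) (Fin 4) ℝ}
    (hg : ∀ y ∈ D.domain, g y = (D.e y)ᵀ * diagonal (D.h y) * D.e y) :
    OrthogonalFrame g D.domain where
  e := D.e
  E := D.E
  h := D.h
  ω := D.ω
  de := D.de
  dE := D.dE
  dh := D.dh
  dω := D.dω
  dde := D.dde
  isOpen := D.isOpen_domain
  metric_eq := hg
  mul_dual _ hy := D.e_mul_E hy D.k_ne_zero
  h_ne_zero y hy i := by
    obtain ⟨hR, hQ, hP, -⟩ := hy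
    fin_cases i
    · exact neg_ne_zero.2 (div_ne_zero hQ hR)
    · exact div_ne_zero hR hQ
    · exact div_ne_zero hR hP
    · exact div_ne_zero hP hR
  hasPDeriv_e y _ μ := D.hasMatPDeriv_e μ y
  hasPDeriv_E _ hy μ := D.hasMatPDeriv_E hy μ D.k_ne_zero
  hasPDeriv_h _ hy μ := D.hasPDeriv_h hy μ
  hasPDeriv_ω _ hy μ ν := D.hasMatPDeriv_ω hy μ ν
  hasPDeriv_de _ _ μ ν := D.hasMatPDeriv_de μ ν
  dde_symm _ _ μ ν := D.dde_symm μ ν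
  torsionFree _ hy := D.torsionFree hy
  isMetric _ hy := D.isMetric hy

set_option maxHeartbeats 1600000 in
/-- The Kretschmann scalar of a metric of Carter's class. -/
theorem kretschmann_eq {g : (Fin 4 → ℝ) → Matrix (Fin 4) (Fin 4) ℝ}
    (hg : ∀ y ∈ D.domain, g y = (D.e y)ᵀ * diagonal (D.h y) * D.e y) (hy : y ∈ D.domain) :
    kretschmann g y
      = 4 * (D.Wα y ^ 2 + D.Wδ y ^ 2 + 4 * D.Wγ y ^ 2 - 3 * D.Wβ y ^ 2) := by
  rw [(D.frame hg).kretschmann_eq hy (D.W y)]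
  · change ∑ a, ∑ b, ∑ c, ∑ d, D.W y a b c d ^ 2
      * ((D.h y a)⁻¹ * (D.h y b)⁻¹ * ((D.h y c)⁻¹ * (D.h y d)⁻¹)) = _
    obtain ⟨hR, hQ, hP, -⟩ := hy
    -- Here `h_0 h_1 = -1` and `h_2 h_3 = 1`, while the four mixed pairs have `W_{abab} = -γ h_a
    -- h_b`. Thus α² and δ² come with weight 4 and γ² with 16. Since `h_0 h_1 h_2 h_3 = -1`, the β
    -- terms give −(8 + 2 + 2)β².
    simp only [Fin.sum_univ_four, W, form01, form02, form03, h, Matrix.neg_apply,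
      Matrix.zero_apply, Matrix.of_apply, Matrix.cons_val, neg_zero, neg_sq, neg_neg, ne_eq,
      OfNat.ofNat_ne_zero, not_false_eq_true, zero_pow, zero_mul, add_zero, zero_add, QdivP, PdivQ,
      QdivR, PdivR]
    field_simp
    ring
  · intro μ ν a b
    change D.h y a * D.curv μ ν y a b = ∑ c, ∑ d, D.W y a b c d * D.e y c μ * D.e y d ν
    rw [D.h_mul_curv hy, Matrix.mul_apply]
    simp only [Matrix.mul_apply, Matrix.transpose_apply, Finset.sum_mul]
    rw [Finset.sum_comm]
    exact Finset.sum_congr rfl fun c _ => Finset.sum_congr rfl fun d _ => by ring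

end CarterData

end

end CoordGeom

/-! ### The Kerr–Newman–(anti-)de Sitter metric -/

namespace KNdS

open CoordGeom Matrix

noncomputable section

/-- The Kerr-Newman-(anti-)de Sitter metric belongs to Carter's class. -/
def carterData (a m q Λ : ℝ) (hΞ : Xi a Λ ≠ 0) : CarterData where
  a := a
  k := 1 / Xi a Λ
  Q := DeltaR a m q Λ
  Q' r := -(4 * Λ / 3) * r ^ 3 + 2 * (1 - Λ / 3 * a ^ 2) * r - 2 * m
  Q'' r := -(4 * Λ) * r ^ 2 + 2 * (1 - Λ / 3 * a ^ 2)
  P u := (1 + a ^ 2 * Λ / 3 * u ^ 2) * (1 - u ^ 2)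
  P' u := 2 * (a ^ 2 * Λ / 3 - 1) * u - 4 * (a ^ 2 * Λ / 3) * u ^ 3
  P'' u := 2 * (a ^ 2 * Λ / 3 - 1) - 12 * (a ^ 2 * Λ / 3) * u ^ 2
  k_ne_zero := one_div_ne_zero hΞ
  hasDerivAt_Q r := by
    have h2 := hasDerivAt_pow 2 r
    have h := ((((h2.const_mul (Λ / 3)).const_sub 1).mul (h2.add_const (a ^ 2))).sub
      ((hasDerivAt_id r).const_mul (2 * m))).add_const (q ^ 2)
    refine h.congr_deriv ?_
    norm_num
    ring
  hasDerivAt_Q' r := by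
    have h := (((hasDerivAt_pow 3 r).const_mul (-(4 * Λ / 3))).add
      ((hasDerivAt_id r).const_mul (2 * (1 - Λ / 3 * a ^ 2)))).sub_const (2 * m)
    refine h.congr_deriv ?_
    norm_num
    ring
  hasDerivAt_P u := by
    have h2 := hasDerivAt_pow 2 u
    have h := ((h2.const_mul (a ^ 2 * Λ / 3)).const_add 1).mul (h2.const_sub 1)
    refine h.congr_deriv ?_
    norm_num
    ring
  hasDerivAt_P' u := by
    have h := ((hasDerivAt_id u).const_mul (2 * (a ^ 2 * Λ / 3 - 1))).sub
      ((hasDerivAt_pow 3 u).const_mul (4 * (a ^ 2 * Λ / 3)))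
    refine h.congr_deriv ?_
    norm_num
    ring

variable {a m q Λ : ℝ} (hΞ : Xi a Λ ≠ 0)

/-- Putting sin²θ into P turns (ρ²/Δ_θ) dθ² into (ρ²/P)(d cos θ)² and makes P a polynomial in cos θ.
-/
theorem metric_eq_frame (y : Fin 4 → ℝ) (hy : y ∈ (carterData a m q Λ hΞ).domain) :
    metric a m q Λ y = ((carterData a m q Λ hΞ).e y)ᵀ * diagonal ((carterData a m q Λ hΞ).h y)
      * (carterData a m q Λ hΞ).e y := by
  obtain ⟨hR, hQ, hP, hs⟩ := hy
  have hP' : DeltaTheta a Λ (y 2) ≠ 0 := left_ne_zero_of_mul hP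
  have hPe : (carterData a m q Λ hΞ).P (cos (y 2)) = DeltaTheta a Λ (y 2) * sin (y 2) ^ 2 := by
    rw [sin_sq]; rfl
  have hRe : (carterData a m q Λ hΞ).R y = rhoSq a (y 1) (y 2) := rfl
  have hQe : (carterData a m q Λ hΞ).Q (y 1) = DeltaR a m q Λ (y 1) := rfl
  have hae : (carterData a m q Λ hΞ).a = a := rfl
  have hke : (carterData a m q Λ hΞ).k = 1 / Xi a Λ := rfl
  rw [hRe] at hR
  rw [hQe] at hQ
  have hc : 1 - cos (y 2) ^ 2 = sin (y 2) ^ 2 := (sin_sq _).symm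
  ext i j
  fin_cases i <;> fin_cases j <;>
    simp only [metric, CarterData.e, CarterData.h, hPe, hRe, hQe, hae, hke, hc, Matrix.mul_apply,
      Matrix.diagonal_apply, Matrix.transpose_apply, Fin.sum_univ_four, Matrix.of_apply,
      Matrix.cons_val, Fin.zero_eta, Fin.mk_one, Fin.reduceFinMk, Fin.reduceEq, if_true, if_false]
  all_goals try field_simp
  all_goals try ring

/-- With z = r + i a cos θ, the coefficients of Λ², m², mq² and q⁴ in the bracket are 8|z|¹², 144 Re
z⁶, −288 Re z⁵ and 24(6 Re z⁴ + |z|⁴). The expanded formulas follow from this grouping. -/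
theorem kretschmann_metric (y : Fin 4 → ℝ) (hy : Regular a m q Λ y) :
    kretschmann (metric a m q Λ) y = 1 / (3 * (y 1 ^ 2 + a ^ 2 * cos (y 2) ^ 2) ^ 6) *
      (8 * Λ ^ 2 * (y 1 ^ 2 + a ^ 2 * cos (y 2) ^ 2) ^ 6
        + 144 * m ^ 2 * (y 1 ^ 6 - 15 * a ^ 2 * y 1 ^ 4 * cos (y 2) ^ 2
          + 15 * a ^ 4 * y 1 ^ 2 * cos (y 2) ^ 4 - a ^ 6 * cos (y 2) ^ 6)
        - 288 * m * q ^ 2 * y 1 * (y 1 ^ 4 - 10 * a ^ 2 * y 1 ^ 2 * cos (y 2) ^ 2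
          + 5 * a ^ 4 * cos (y 2) ^ 4)
        + 24 * q ^ 4 * (7 * y 1 ^ 4 - 34 * a ^ 2 * y 1 ^ 2 * cos (y 2) ^ 2
          + 7 * a ^ 4 * cos (y 2) ^ 4)) := by
  obtain ⟨hΞ, hR, hQ, hT, hs⟩ := hy
  have hdom : y ∈ (carterData a m q Λ hΞ).domain := by
    refine ⟨hR, hQ, ?_, hs⟩
    change DeltaTheta a Λ (y 2) * (1 - cos (y 2) ^ 2) ≠ 0
    rw [← sin_sq]
    exact mul_ne_zero hT (pow_ne_zero 2 hs)
  rw [(carterData a m q Λ hΞ).kretschmann_eq (metric_eq_frame hΞ) hdom]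
  have hR' : y 1 ^ 2 + a ^ 2 * cos (y 2) ^ 2 ≠ 0 := hR
  simp only [CarterData.Wα, CarterData.Wβ, CarterData.Wγ, CarterData.Wδ, CarterData.R, carterData,
    DeltaR]
  field_simp
  ring

end

end KNdS

theorem mainTheorem3 :
    -- Kerr-Newman-(anti-)de Sitter
    (∀ (a m q Λ t r θ φ : ℝ), KNdS.Regular a m q Λ ![t, r, θ, φ] →
      CoordGeom.kretschmann (KNdS.metric a m q Λ) ![t, r, θ, φ] =
        1 / (3 * (r ^ 2 + a ^ 2 * Real.cos θ ^ 2) ^ 6) *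
          (8 * Λ ^ 2 * Real.cos θ ^ 12 * a ^ 12
            + 48 * Λ ^ 2 * Real.cos θ ^ 10 * a ^ 10 * r ^ 2
            + 120 * Λ ^ 2 * Real.cos θ ^ 8 * a ^ 8 * r ^ 4
            + (160 * Λ ^ 2 * a ^ 6 * r ^ 6 - 144 * a ^ 6 * m ^ 2) * Real.cos θ ^ 6
            + 2160 * (1 / 18 * r ^ 8 * Λ ^ 2 + m ^ 2 * r ^ 2 - 2 / 3 * m * q ^ 2 * r
                + 7 / 90 * q ^ 4) * a ^ 4 * Real.cos θ ^ 4
            - 2160 * (-(1 / 45) * r ^ 8 * Λ ^ 2 + m ^ 2 * r ^ 2 - 4 / 3 * m * q ^ 2 * r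
                + 17 / 45 * q ^ 4) * a ^ 2 * r ^ 2 * Real.cos θ ^ 2
            + 8 * Λ ^ 2 * r ^ 12 + 144 * m ^ 2 * r ^ 6 - 288 * m * q ^ 2 * r ^ 5
            + 168 * q ^ 4 * r ^ 4)) ∧
    -- Reissner-Nordström-(anti-)de Sitter: `a = 0`
    (∀ (m q Λ t r θ φ : ℝ), KNdS.Regular 0 m q Λ ![t, r, θ, φ] →
      CoordGeom.kretschmann (KNdS.metric 0 m q Λ) ![t, r, θ, φ] =
        (8 * Λ ^ 2 * r ^ 12 + 144 * m ^ 2 * r ^ 6 - 288 * m * q ^ 2 * r ^ 5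
          + 168 * q ^ 4 * r ^ 4) / (3 * r ^ 12)) ∧
    -- Kerr-Newman: `Λ = 0`
    (∀ (a m q t r θ φ : ℝ), KNdS.Regular a m q 0 ![t, r, θ, φ] →
      CoordGeom.kretschmann (KNdS.metric a m q 0) ![t, r, θ, φ] =
        1 / (r ^ 2 + a ^ 2 * Real.cos θ ^ 2) ^ 6 *
          (-48 * Real.cos θ ^ 6 * a ^ 6 * m ^ 2
            + 720 * (m ^ 2 * r ^ 2 - 2 / 3 * m * q ^ 2 * r + 7 / 90 * q ^ 4)
                * a ^ 4 * Real.cos θ ^ 4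
            - 720 * (m ^ 2 * r ^ 2 - 4 / 3 * m * q ^ 2 * r + 17 / 45 * q ^ 4)
                * a ^ 2 * r ^ 2 * Real.cos θ ^ 2
            + 48 * m ^ 2 * r ^ 6 - 96 * m * q ^ 2 * r ^ 5 + 56 * q ^ 4 * r ^ 4)) ∧
    -- Reissner-Nordström: `a = 0`, `Λ = 0`
    (∀ (m q t r θ φ : ℝ), KNdS.Regular 0 m q 0 ![t, r, θ, φ] →
      CoordGeom.kretschmann (KNdS.metric 0 m q 0) ![t, r, θ, φ] =
        (144 * m ^ 2 * r ^ 6 - 288 * m * q ^ 2 * r ^ 5 + 168 * q ^ 4 * r ^ 4)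
          / (3 * r ^ 12)) := by
  refine ⟨?_, ?_, ?_, ?_⟩
  · intro a m q Λ t r θ φ h
    rw [KNdS.kretschmann_metric _ h]
    simp only [Matrix.cons_val]
    ring
  · intro m q Λ t r θ φ h
    rw [KNdS.kretschmann_metric _ h]
    simp only [Matrix.cons_val]
    ring
  · intro a m q t r θ φ h
    rw [KNdS.kretschmann_metric _ h]
    -- Splitting the inverse isolates the factor 1/3, which is absorbed into the coefficients.
    simp only [Matrix.cons_val, one_div, mul_inv]
    ring
  · intro m q t r θ φ h
    rw [KNdS.kretschmann_metric _ h]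
    simp only [Matrix.cons_val]
    ring
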